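/- Conventions. A configuration of a prime alternating knot is a reduced alternating diagram, on the sphere, of a knot (one component, at least one crossing), which is prime: no disc whose boundary meets the diagram transversally in exactly two points, away from the crossings, has crossings both inside and outside it. An $n$-tangle is the part of the diagram in a disc whose boundary meets the diagram transversally in $n$ points, away from the crossings; it is identified with its set of crossings, and the $n$ arcs that meet the boundary of the disc are its incident arcs. A group is a maximal set of crossings any two of which are linked by a chain of two-sided faces; a $k$-group is a group with $k$ crossings, and a $1$-group is called a loner. Let $G$ be a group that is not the whole diagram. Its four incident arcs fall into two opposite ends, each consisting of two neighbouring arcs at one crossing (for a loner there are two ways to choose the ends, and both are allowed). Fix such a choice and one of the two ends. Consider the empty set together with all 4-tangles $X$, disjoint from $G$, for which both arcs of this end are among the four incident arcs of $X$; these are the tangles across which $G$ can be flyped from this end, and they form a chain under inclusion. The sets $Y\setminus X$, for consecutive members $X\subsetneq Y$ of this chain, are called min-tangles in the orbit of $G$. The configuration is a full group configuration if for no group $G$ there are such an $X$ (possibly empty) and a crossing $d\notin X$ for which $X\cup\{d\}$ is again one of these tangles, that is, if no crossing can be flyped so as to enlarge a group. A drots 2-group is a 2-group $G_D$ (positive or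 negative) that is a min-tangle in the orbit of some group $G$; such a group $G$ is called the orbiter group of $G_D$. An OTS 6-tangle is a 6-tangle that consists of exactly three crossings, which are the corners of a three-sided face. A loner is adjacent to $G_D$ if two neighbouring arcs at its crossing both lead directly to crossings of $G_D$. Proposition. Let $C(K)$ be a full group configuration of a prime alternating knot $K$, and let $G_D$ be a drots 2-group (positive or negative) such that some OTS 6-tangle in $C(K)$ contains a crossing of $G_D$. Then the orbiter group $G$ of $G_D$ is a loner, and it is adjacent to $G_D$. -/

import Mathlib

/-- A link diagram on a closed oriented surface with set of crossings `V`. The four half-arcs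
("darts") at a crossing `v` are `(v, 0), (v, 1), (v, 2), (v, 3)`, in counterclockwise order; the
strand through `(v, 0), (v, 2)` passes over the strand through `(v, 1), (v, 3)`.
`opp` sends a dart to the other end of the arc on which it lies. -/
structure LinkDiagram (V : Type*) where
  opp : Equiv.Perm (V × ZMod 4)
  opp_opp : ∀ d, opp (opp d) = d
  opp_ne : ∀ d, opp d ≠ d

namespace LinkDiagram

/-- Rotation of all darts by `k` quarter turns counterclockwise about their crossings. -/
def turn {V : Type*} (k : ZMod 4) : Equiv.Perm (V × ZMod 4) :=
  Equiv.prodCongr (Equiv.refl V) (Equiv.addRight k)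

section Basic

variable {V : Type*} (D : LinkDiagram V)

/-- Walk along an arc and go straight ahead at the crossing that is reached. -/
def straight : Equiv.Perm (V × ZMod 4) := D.opp.trans (turn 2)

/-- Walk along an arc and turn left at the crossing that is reached; the cycles of this
permutation are the faces of the diagram. -/
def face : Equiv.Perm (V × ZMod 4) := D.opp.trans (turn (-1))

/-- There is at least one crossing and exactly one component: any two darts lie on one closed
strand, traversed in the same or in opposite directions. -/
def IsKnot : Prop :=
  Nonempty V ∧ ∀ a b, D.straight.SameCycle a b ∨ D.straight.SameCycle a (D.opp b)

/-- Euler's formula `#V - #E + #F = 2` with `#E = 2 * #V`: for a connected diagram (in particular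
for a knot) the surface on which the diagram is drawn is the sphere. -/
def IsSpherical : Prop :=
  Nat.card (Quotient (Equiv.Perm.SameCycle.setoid D.face)) = Nat.card V + 2

/-- Every arc runs from an overpass to an underpass. -/
def IsAlternating : Prop := ∀ d, Even (D.opp d).2 ↔ ¬ Even d.2

/-- No crossing is nugatory: opposite corners at a crossing belong to different faces. -/
def IsReduced : Prop := ∀ d, ¬ D.face.SameCycle d (turn 2 d)

/-- The distinct crossings `u` and `v` are the two corners of a face with two sides. -/
def Bigon (u v : V) : Prop :=
  u ≠ v ∧ ∃ i j, D.opp (u, i) = (v, j) ∧ D.opp (u, i + 1) = (v, j - 1)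

/-- A group: a maximal set of crossings in which any two are linked by a chain of two-sided
faces (a maximal row of half twists, or a single crossing that is in no such row). -/
def IsGroup (G : Finset V) : Prop :=
  ∃ v, ∀ w, w ∈ G ↔ Relation.EqvGen D.Bigon v w

/-- A loner is a group that consists of a single crossing. -/
def IsLoner (G : Finset V) : Prop := D.IsGroup G ∧ G.card = 1

end Basic

section Tangles

variable {V : Type*} [Fintype V] [DecidableEq V] (D : LinkDiagram V)

/-- The darts at crossings of `T` on the arcs that leave `T`; the arcs incident to the tangle
with set of crossings `T` correspond to them. -/
def boundary (T : Finset V) : Finset (V × ZMod 4) :=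
  Finset.univ.filter fun d => d.1 ∈ T ∧ (D.opp d).1 ∉ T

/-- Prime: there is no 2-tangle with crossings both inside and outside it. -/
def IsPrime : Prop := ∀ T : Finset V, (D.boundary T).card ≠ 2

/-- A configuration of a prime alternating knot. -/
structure IsPrimeAlternatingKnot : Prop where
  knot : D.IsKnot
  spherical : D.IsSpherical
  alternating : D.IsAlternating
  reduced : D.IsReduced
  prime : D.IsPrime

/-- `p` stands for the pair of neighbouring darts `p`, `turn 1 p` at one crossing, and these are
two of the incident arcs of `G`. -/
def IsEnd (G : Finset V) (p : V × ZMod 4) : Prop :=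
  p ∈ D.boundary G ∧ turn 1 p ∈ D.boundary G

/-- A direction in which `G` can be flyped: the four arcs incident to `G` are divided into
two opposite ends `p, turn 1 p` and `q, turn 1 q`. A group of two or more crossings that is not
the whole diagram has one such division (up to exchanging the ends), a loner has two. -/
def IsAxis (G : Finset V) (p q : V × ZMod 4) : Prop :=
  (D.boundary G).card = 4 ∧ D.boundary G = {p, turn 1 p, q, turn 1 q}

/-- `X` is a tangle across which `G` can be flyped starting from its end `p`: either `X` is empty
(`G` stays where it is), or `X` is a 4-tangle outside `G` which has the two arcs at the end `p` of
`G` among its four incident arcs. The other two incident arcs of `X` are the position to which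
`G` is moved by the flype. -/
def IsSegment (G : Finset V) (p : V × ZMod 4) (X : Finset V) : Prop :=
  X = ∅ ∨ (Disjoint X G ∧ (D.boundary X).card = 4 ∧
    D.opp p ∈ D.boundary X ∧ D.opp (turn 1 p) ∈ D.boundary X)

/-- `T` is a min-tangle in the orbit of `G`: the tangle between two consecutive positions of
`G` along one of its directions. -/
def IsMinTangle (G T : Finset V) : Prop :=
  ∃ p q, D.IsAxis G p q ∧ ∃ X Y, D.IsSegment G p X ∧ D.IsSegment G p Y ∧ X ⊂ Y ∧
    (∀ Z, D.IsSegment G p Z → X ⊆ Z → Z ⊆ Y → Z = X ∨ Z = Y) ∧ T = Y \ X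

/-- The group `G` is full: there is no further crossing `d` which could be flyped across a tangle
`X` between `G` and `d` to a place next to an end of `G`, where it would enlarge the group. -/
def IsFullGroup (G : Finset V) : Prop :=
  D.IsGroup G ∧ ∀ p q, D.IsAxis G p q → ∀ X d, d ∉ X → D.IsSegment G p X →
    ¬ D.IsSegment G p (insert d X)

/-- All groups are full. -/
def IsFullGroupConfiguration : Prop := ∀ G, D.IsGroup G → D.IsFullGroup G

/-- The group `G` is an orbiter of `T`: `T` is a min-tangle in the orbit of `G`. -/
def IsOrbiter (G T : Finset V) : Prop := D.IsGroup G ∧ D.IsMinTangle G T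

/-- A drots 2-group, of either sign: a group of two crossings that is a min-tangle in the orbit
of some group. -/
def IsDrotsTwoGroup (H : Finset V) : Prop :=
  D.IsGroup H ∧ H.card = 2 ∧ ∃ G, D.IsOrbiter G H

/-- An OTS 6-tangle: three crossings that are the corners of a three-sided face, with six incident
arcs (three strands, any two of which cross exactly once in the tangle). -/
def IsOTSTangle (T : Finset V) : Prop :=
  T.card = 3 ∧ (D.boundary T).card = 6 ∧
    ∃ d, D.face (D.face (D.face d)) = d ∧ T = {d.1, (D.face d).1, (D.face (D.face d)).1}

/-- `G` is in a position adjacent to `H`: both arcs at one end of `G` lead directly to `H`. -/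
def IsAdjacent (G H : Finset V) : Prop :=
  ∃ p, D.IsEnd G p ∧ (D.opp p).1 ∈ H ∧ (D.opp (turn 1 p)).1 ∈ H

end Tangles

end LinkDiagram

/-! Let `H = Y \ X` be the min-tangle, `G` the orbiter and `R` the set of crossings outside `Y` and
`G`. On the sphere `G`, `X`, `H`, `R` form a ring in which neighbours are joined by two arcs; `X` or
`R` may be empty, and then `H` is joined directly to that end of `G`. Exchanging the ends of `G`
exchanges `X` and `R`. Two sides of the triangle leave `H` at its crossing `c`. By minimality of `H`
they leave it in different directions, so that the third side joins the two neighbours of `H` in the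
ring. If `X` and `R` are nonempty, no arc joins these. If exactly one of them is empty, such an arc
runs from one end of `G` along an arc of the other end, whence both ends are at one crossing. If
both are empty, it runs between the ends of `G` inside `G`, where it would be a side of a bigon; but
any two crossings of the triangle are joined by only one arc. -/

namespace LinkDiagram

section Darts

variable {V : Type*} {D : LinkDiagram V}

theorem turn_one_ne (d : V × ZMod 4) : turn 1 d ≠ d := fun h =>
  absurd (add_eq_left.1 (congrArg Prod.snd h)) (by decide)

theorem turn_one_face (d : V × ZMod 4) : turn 1 (D.face d) = D.opp d :=
  Prod.ext rfl (neg_add_cancel_right (D.opp d).2 1)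

theorem eq_turn_of_fst_eq {d e : V × ZMod 4} (h : e.1 = d.1) :
    e = d ∨ e = turn 1 d ∨ e = turn 2 d ∨ e = turn 3 d := by
  have hsnd : ∀ k l : ZMod 4, k = l ∨ k = l + 1 ∨ k = l + 2 ∨ k = l + 3 := by decide
  exact (hsnd e.2 d.2).imp (Prod.ext h) (.imp (Prod.ext h) (.imp (Prod.ext h) (Prod.ext h)))

end Darts

section Bigons

variable {V : Type*} {D : LinkDiagram V}

instance : Std.Symm D.Bigon where
  symm := by
    rintro u v ⟨hne, i, j, hij, hij'⟩
    refine ⟨hne.symm, j - 1, i + 1, ?_, ?_⟩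
    · rw [← hij', D.opp_opp]
    · rw [sub_add_cancel, ← hij, D.opp_opp, add_sub_cancel_right]

theorem Bigon.exists_dart {u v : V} (h : D.Bigon u v) :
    ∃ d : V × ZMod 4, d.1 = u ∧ (D.opp d).1 = v ∧ (D.opp (turn 1 d)).1 = v := by
  obtain ⟨-, i, j, hij, hij'⟩ := h
  exact ⟨(u, i), rfl, congrArg Prod.fst hij, congrArg Prod.fst hij'⟩

theorem IsGroup.exists_bigon {G : Finset V} (hG : D.IsGroup G) {u v : V} (hu : u ∈ G)
    (hv : v ∈ G) (huv : u ≠ v) : ∃ w ∈ G, D.Bigon u w := by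
  obtain ⟨g, hg⟩ := hG
  have hgu := (hg u).1 hu
  have huv' : Relation.ReflTransGen D.Bigon u v := by
    rw [← Relation.EqvGen.eqvGen_eq_reflTransGen]
    exact (hgu.symm _ _).trans _ _ _ ((hg v).1 hv)
  obtain rfl | ⟨w, huw, -⟩ := huv'.cases_head
  · exact absurd rfl huv
  · exact ⟨w, (hg w).2 (hgu.trans _ _ _ (.rel _ _ huw)), huw⟩

end Bigons

section Counting

variable {V : Type*} [Fintype V] [DecidableEq V] {D : LinkDiagram V}

theorem mem_boundary {T : Finset V} {d : V × ZMod 4} :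
    d ∈ D.boundary T ↔ d.1 ∈ T ∧ (D.opp d).1 ∉ T := by
  simp [boundary]

variable (D) in
/-- The darts at crossings of `A` on the arcs from `A` to `B`. An arc inside `A ∩ B` contributes
both of its darts, so that `dartsBetween A B` counts incidences rather than arcs. -/
def dartsBetween (A B : Finset V) : Finset (V × ZMod 4) :=
  Finset.univ.filter fun d => d.1 ∈ A ∧ (D.opp d).1 ∈ B

theorem mem_dartsBetween {A B : Finset V} {d : V × ZMod 4} :
    d ∈ D.dartsBetween A B ↔ d.1 ∈ A ∧ (D.opp d).1 ∈ B := by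
  simp [dartsBetween]

theorem boundary_eq_dartsBetween_compl (T : Finset V) :
    D.boundary T = D.dartsBetween T Tᶜ := by
  ext d
  simp only [mem_boundary, mem_dartsBetween, Finset.mem_compl]

theorem card_dartsBetween_comm (A B : Finset V) :
    (D.dartsBetween A B).card = (D.dartsBetween B A).card := by
  apply Finset.card_bij' (fun d _ => D.opp d) (fun d _ => D.opp d) <;>
    simp +contextual [mem_dartsBetween, D.opp_opp]

theorem card_dartsBetween_union_left {A B : Finset V} (h : Disjoint A B) (C : Finset V) :
    (D.dartsBetween (A ∪ B) C).card = (D.dartsBetween A C).card + (D.dartsBetween B C).card := by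
  rw [← Finset.card_union_of_disjoint]
  · congr 1
    ext d
    simp only [mem_dartsBetween, Finset.mem_union, or_and_right]
  · exact Finset.disjoint_left.2 fun d hA hB =>
      Finset.disjoint_left.1 h (mem_dartsBetween.1 hA).1 (mem_dartsBetween.1 hB).1

theorem card_dartsBetween_union_right (A : Finset V) {B C : Finset V} (h : Disjoint B C) :
    (D.dartsBetween A (B ∪ C)).card = (D.dartsBetween A B).card + (D.dartsBetween A C).card := by
  rw [card_dartsBetween_comm, card_dartsBetween_union_left h, card_dartsBetween_comm B,
    card_dartsBetween_comm C]

theorem card_dartsBetween_self_add_card_boundary (T : Finset V) :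
    (D.dartsBetween T T).card + (D.boundary T).card = 4 * T.card := by
  have hall : D.dartsBetween T Finset.univ = T ×ˢ Finset.univ := by
    ext d
    simp only [mem_dartsBetween, Finset.mem_product, Finset.mem_univ]
  rw [boundary_eq_dartsBetween_compl, ← card_dartsBetween_union_right T disjoint_compl_right,
    Finset.union_compl, hall, Finset.card_product, Finset.card_univ, ZMod.card, mul_comm]

theorem card_boundary_compl (T : Finset V) : (D.boundary Tᶜ).card = (D.boundary T).card := by
  rw [boundary_eq_dartsBetween_compl, boundary_eq_dartsBetween_compl, compl_compl,
    card_dartsBetween_comm]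

theorem card_boundary_union_add {A B : Finset V} (h : Disjoint A B) :
    (D.boundary (A ∪ B)).card + 2 * (D.dartsBetween A B).card =
      (D.boundary A).card + (D.boundary B).card := by
  have hA := D.card_dartsBetween_self_add_card_boundary A
  have hB := D.card_dartsBetween_self_add_card_boundary B
  have hAB := D.card_dartsBetween_self_add_card_boundary (A ∪ B)
  rw [Finset.card_union_of_disjoint h, card_dartsBetween_union_left h,
    card_dartsBetween_union_right _ h, card_dartsBetween_union_right _ h,
    card_dartsBetween_comm B A] at hAB
  omega

theorem even_card_boundary (T : Finset V) : Even (D.boundary T).card := by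
  have hself : Even (D.dartsBetween T T).card := by
    rw [← ZMod.natCast_eq_zero_iff_even, Finset.card_eq_sum_ones, Nat.cast_sum]
    refine Finset.sum_involution (fun d _ => D.opp d) (fun _ _ => by decide)
      (fun d _ _ => D.opp_ne d) (fun d hd => ?_) (fun d _ => D.opp_opp d)
    rw [mem_dartsBetween] at hd ⊢
    rw [D.opp_opp]
    exact hd.symm
  have hsum : Even (4 * T.card) := (by decide : Even 4).mul_right _
  rw [← D.card_dartsBetween_self_add_card_boundary T, Nat.even_add] at hsum
  exact hsum.1 hself

variable (D) in
/-- The diagram, as a four-valent graph, is 4-edge-connected: at least four arcs join a nonempty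
set of crossings to a nonempty complement. This is connectedness and primeness in one. -/
def IsFourEdgeConnected : Prop :=
  ∀ T : Finset V, T.Nonempty → Tᶜ.Nonempty → 4 ≤ (D.boundary T).card

theorem IsKnot.boundary_nonempty (hK : D.IsKnot) {T : Finset V} (hT : T.Nonempty)
    (hT' : Tᶜ.Nonempty) : (D.boundary T).Nonempty := by
  obtain ⟨u, hu⟩ := hT
  obtain ⟨v, hv⟩ := hT'
  rw [Finset.mem_compl] at hv
  by_contra hempty
  have hopp : ∀ d, d.1 ∈ T → (D.opp d).1 ∈ T := fun d hd => by
    by_contra hd'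
    exact hempty ⟨d, mem_boundary.2 ⟨hd, hd'⟩⟩
  have hstraight : Set.MapsTo D.straight {d | d.1 ∈ T} {d | d.1 ∈ T} := hopp
  have hcycle : ∀ e, D.straight.SameCycle (u, 0) e → e.1 ∈ T := fun e he => by
    obtain ⟨n, -, rfl⟩ := he.exists_pow_eq'
    exact hstraight.perm_pow n hu
  rcases hK.2 (u, 0) (v, 0) with h | h
  · exact hv (hcycle _ h)
  · exact hv (by simpa only [D.opp_opp] using hopp _ (hcycle _ h))

theorem IsKnot.isFourEdgeConnected (hK : D.IsKnot) (hP : D.IsPrime) :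
    D.IsFourEdgeConnected := fun T hT hT' => by
  have hpos := (hK.boundary_nonempty hT hT').card_pos
  have htwo := hP T
  obtain ⟨m, hm⟩ := D.even_card_boundary T
  omega

theorem IsFourEdgeConnected.card_boundary_singleton (hD : D.IsFourEdgeConnected) {u v : V}
    (huv : u ≠ v) : (D.boundary {u}).card = 4 := by
  have hle := D.card_dartsBetween_self_add_card_boundary {u}
  have hge := hD {u} (Finset.singleton_nonempty u) ⟨v, by simpa using huv.symm⟩
  rw [Finset.card_singleton] at hle
  omega

end Counting

section Triangles

variable {V : Type*} [Fintype V] [DecidableEq V] {D : LinkDiagram V} {T : Finset V}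

namespace IsOTSTangle

theorem exists_corner (hT : D.IsOTSTangle T) {c : V} (hc : c ∈ T) :
    ∃ d : V × ZMod 4, d.1 = c ∧ (D.opp d).1 ∈ T.erase c ∧ (D.opp (turn 1 d)).1 ∈ T.erase c ∧
      (D.opp d).1 ≠ (D.opp (turn 1 d)).1 := by
  obtain ⟨d, rfl, hd, hTd⟩ : ∃ d : V × ZMod 4, d.1 = c ∧ D.face (D.face (D.face d)) = d ∧
      T = {d.1, (D.face d).1, (D.face (D.face d)).1} := by
    obtain ⟨-, -, d, hd, hTd⟩ := hT
    have hc' := hc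
    simp only [hTd, Finset.mem_insert, Finset.mem_singleton] at hc'
    rcases hc' with h | h | h
    · exact ⟨d, h.symm, hd, hTd⟩
    · exact ⟨D.face d, h.symm, by rw [hd], by rw [hTd, hd]; grind⟩
    · exact ⟨D.face (D.face d), h.symm, by rw [hd], by rw [hTd, hd]; grind⟩
  have hopp : D.opp (turn 1 d) = D.face (D.face d) := by
    rw [← D.opp_opp (D.face (D.face d)), ← turn_one_face (D.face (D.face d)), hd]
  have hcard := hT.1
  rw [hTd] at hcard
  refine ⟨d, rfl, ?_⟩
  rw [hopp, hTd, show (D.opp d).1 = (D.face d).1 from rfl]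
  grind

theorem exists_dart (hT : D.IsOTSTangle T) {u v : V} (hu : u ∈ T) (hv : v ∈ T) (huv : u ≠ v) :
    ∃ d : V × ZMod 4, d.1 = u ∧ (D.opp d).1 = v := by
  obtain ⟨d, hd, hleft, hright, hne⟩ := hT.exists_corner hu
  have herase : {(D.opp d).1, (D.opp (turn 1 d)).1} = T.erase u := by
    apply Finset.eq_of_subset_of_card_le
    · exact Finset.insert_subset hleft (Finset.singleton_subset_iff.2 hright)
    · rw [Finset.card_pair hne, Finset.card_erase_of_mem hu, hT.1]
  have hv' : v ∈ T.erase u := Finset.mem_erase.2 ⟨huv.symm, hv⟩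
  rw [← herase, Finset.mem_insert, Finset.mem_singleton] at hv'
  rcases hv' with rfl | rfl
  · exact ⟨d, hd, rfl⟩
  · exact ⟨turn 1 d, hd, rfl⟩

/-- There are six ordered pairs of distinct corners, and only six darts on arcs inside the
tangle. -/
theorem injOn_endpoints (hT : D.IsOTSTangle T) :
    Set.InjOn (fun d => (d.1, (D.opp d).1)) (D.dartsBetween T T : Set (V × ZMod 4)) := by
  have hinner := D.card_dartsBetween_self_add_card_boundary T
  rw [hT.1, hT.2.1] at hinner
  have hpairs : T.offDiag ⊆ (D.dartsBetween T T).image fun d => (d.1, (D.opp d).1) := by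
    rintro ⟨u, v⟩ huv
    obtain ⟨hu, hv, hne⟩ := Finset.mem_offDiag.1 huv
    obtain ⟨d, rfl, rfl⟩ := hT.exists_dart hu hv hne
    exact Finset.mem_image_of_mem _ (mem_dartsBetween.2 ⟨hu, hv⟩)
  have hcard := Finset.card_le_card hpairs
  rw [Finset.offDiag_card, hT.1] at hcard
  exact Finset.card_image_iff.1 (Finset.card_image_le.antisymm (by omega))

theorem not_bigon (hT : D.IsOTSTangle T) {u v : V} (hu : u ∈ T) (hv : v ∈ T) :
    ¬ D.Bigon u v := fun h => by
  obtain ⟨d, rfl, hd, hd'⟩ := h.exists_dart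
  refine turn_one_ne d (hT.injOn_endpoints ?_ ?_ (Prod.ext rfl (hd'.trans hd.symm)))
  · exact mem_dartsBetween.2 ⟨hu, hd' ▸ hv⟩
  · exact mem_dartsBetween.2 ⟨hu, hd ▸ hv⟩

theorem inter_eq_singleton (hT : D.IsOTSTangle T) {H : Finset V} (hH : D.IsGroup H)
    (hcard : H.card = 2) {c : V} (hc : c ∈ H) (hcT : c ∈ T) : H ∩ T = {c} := by
  obtain ⟨v, hv, hvc⟩ := (Finset.one_lt_card_iff_nontrivial.1 (hcard ▸ one_lt_two)).exists_ne c
  obtain ⟨w, hw, hcw⟩ := hH.exists_bigon hc hv hvc.symm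
  have hHcw : {c, w} = H := by
    apply Finset.eq_of_subset_of_card_le
    · exact Finset.insert_subset hc (Finset.singleton_subset_iff.2 hw)
    · rw [hcard, Finset.card_pair hcw.1]
  have hwT : w ∉ T := fun hwT => hT.not_bigon hcT hwT hcw
  rw [← hHcw, Finset.insert_inter_of_mem hcT, Finset.singleton_inter_of_notMem hwT,
    insert_empty_eq]

theorem exists_isEnd_of_inter_eq_singleton (hT : D.IsOTSTangle T) {H : Finset V} {c : V}
    (hHT : H ∩ T = {c}) :
    ∃ d, D.IsEnd {c} d ∧ D.IsEnd H d ∧ (D.opp d).1 ∈ T ∧ (D.opp (turn 1 d)).1 ∈ T ∧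
      (D.opp d).1 ≠ (D.opp (turn 1 d)).1 := by
  obtain ⟨hcH, hcT⟩ := Finset.mem_inter.1 (hHT.symm ▸ Finset.mem_singleton_self c)
  obtain ⟨d, rfl, hd, hd', hne⟩ := hT.exists_corner hcT
  have hout : ∀ v ∈ T.erase d.1, v ∉ ({d.1} : Finset V) ∧ v ∉ H := fun v hv => by
    obtain ⟨hvd, hvT⟩ := Finset.mem_erase.1 hv
    have hvd' : v ∉ ({d.1} : Finset V) := fun hv' => hvd (Finset.mem_singleton.1 hv')
    exact ⟨hvd', fun hvH => hvd' (hHT ▸ Finset.mem_inter.2 ⟨hvH, hvT⟩)⟩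
  have hdd : d.1 ∈ ({d.1} : Finset V) := Finset.mem_singleton_self d.1
  exact ⟨d, ⟨mem_boundary.2 ⟨hdd, (hout _ hd).1⟩, mem_boundary.2 ⟨hdd, (hout _ hd').1⟩⟩,
    ⟨mem_boundary.2 ⟨hcH, (hout _ hd).2⟩, mem_boundary.2 ⟨hcH, (hout _ hd').2⟩⟩,
    Finset.mem_of_mem_erase hd, Finset.mem_of_mem_erase hd', hne⟩

end IsOTSTangle

end Triangles

section Ends

variable {V : Type*} [DecidableEq V] {D : LinkDiagram V}

/-- The two neighbouring darts for which `p` stands in `IsEnd` and `IsAxis`. -/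
def endDarts (p : V × ZMod 4) : Finset (V × ZMod 4) := {p, turn 1 p}

theorem card_endDarts (p : V × ZMod 4) : (endDarts p).card = 2 :=
  Finset.card_pair (turn_one_ne p).symm

theorem fst_eq_of_mem_endDarts {p d : V × ZMod 4} (h : d ∈ endDarts p) : d.1 = p.1 := by
  rw [endDarts, Finset.mem_insert, Finset.mem_singleton] at h
  rcases h with rfl | rfl <;> rfl

variable [Fintype V] {G : Finset V} {p q : V × ZMod 4}

theorem isEnd_iff : D.IsEnd G p ↔ endDarts p ⊆ D.boundary G := by
  rw [IsEnd, endDarts, Finset.insert_subset_iff, Finset.singleton_subset_iff]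

theorem IsEnd.fst_mem (h : D.IsEnd G p) : p.1 ∈ G := (mem_boundary.1 h.1).1

/-- The other crossings of `G` are met only by the two darts opposite to the end. -/
theorem IsEnd.bigon (h : D.IsEnd G p) (hG : D.IsGroup G) {γ : V × ZMod 4} (hγ : γ.1 = p.1)
    (hγG : (D.opp γ).1 ∈ G) (hne : p.1 ≠ (D.opp γ).1) : D.Bigon p.1 (D.opp γ).1 := by
  obtain ⟨w, hw, hbigon⟩ := hG.exists_bigon h.fst_mem hγG hne
  obtain ⟨δ, hδ, hδw, hδw'⟩ := hbigon.exists_dart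
  have hinner : ∀ f : V × ZMod 4, f.1 = p.1 → (D.opp f).1 ∈ G → f = turn 2 p ∨ f = turn 3 p := by
    intro f hf hfG
    rcases eq_turn_of_fst_eq hf with rfl | rfl | hf | hf
    · exact absurd hfG (mem_boundary.1 h.1).2
    · exact absurd hfG (mem_boundary.1 h.2).2
    · exact .inl hf
    · exact .inr hf
  have hγδ : γ = δ ∨ γ = turn 1 δ := by
    have hδne := turn_one_ne δ
    have h₁ := hinner γ hγ hγG
    have h₂ := hinner δ hδ (hδw ▸ hw)
    have h₃ := hinner (turn 1 δ) hδ (hδw' ▸ hw)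
    grind
  rcases hγδ with rfl | rfl
  · exact hδw ▸ hbigon
  · exact hδw' ▸ hbigon

namespace IsAxis

theorem boundary_eq (h : D.IsAxis G p q) : D.boundary G = endDarts p ∪ endDarts q := by
  rw [h.2, endDarts, endDarts, Finset.insert_union, Finset.singleton_union]

theorem disjoint_endDarts (h : D.IsAxis G p q) : Disjoint (endDarts p) (endDarts q) := by
  rw [← Finset.card_union_eq_card_add_card, ← h.boundary_eq, h.1, card_endDarts, card_endDarts]

theorem isEnd (h : D.IsAxis G p q) : D.IsEnd G p :=
  isEnd_iff.2 (h.boundary_eq ▸ Finset.subset_union_left)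

theorem symm (h : D.IsAxis G p q) : D.IsAxis G q p :=
  ⟨h.1, by rw [h.boundary_eq, Finset.union_comm, endDarts, endDarts, Finset.insert_union,
    Finset.singleton_union]⟩

theorem mem_endDarts_of_notMem (h : D.IsAxis G p q) {d : V × ZMod 4} (hd : d ∈ D.boundary G)
    (hdp : d ∉ endDarts p) : d ∈ endDarts q :=
  (Finset.mem_union.1 (h.boundary_eq ▸ hd)).resolve_left hdp

theorem isLoner (h : D.IsAxis G p q) (hG : D.IsGroup G) (hpq : p.1 = q.1) : D.IsLoner G := by
  have hat : D.boundary G ⊆ ({p.1} : Finset V) ×ˢ Finset.univ := fun d hd => by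
    rw [h.boundary_eq, Finset.mem_union] at hd
    rw [Finset.mem_product, Finset.mem_singleton]
    exact ⟨hd.elim fst_eq_of_mem_endDarts fun hdq => (fst_eq_of_mem_endDarts hdq).trans hpq.symm,
      Finset.mem_univ _⟩
  have hall : D.boundary G = {p.1} ×ˢ Finset.univ := by
    refine Finset.eq_of_subset_of_card_le hat ?_
    rw [h.1, Finset.card_product, Finset.card_univ, ZMod.card, Finset.card_singleton]
  refine ⟨hG, Finset.card_eq_one.2 ⟨p.1, ?_⟩⟩
  refine Finset.eq_singleton_iff_unique_mem.2 ⟨h.isEnd.fst_mem, fun v hv => ?_⟩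
  by_contra hne
  obtain ⟨w, hw, hbigon⟩ := hG.exists_bigon h.isEnd.fst_mem hv (Ne.symm hne)
  obtain ⟨d, hd, hdw, -⟩ := hbigon.exists_dart
  have hdG : d ∈ D.boundary G := by
    rw [hall, Finset.mem_product, Finset.mem_singleton]
    exact ⟨hd, Finset.mem_univ _⟩
  exact (mem_boundary.1 hdG).2 (hdw ▸ hw)

end IsAxis

end Ends

section Segments

variable {V : Type*} [Fintype V] [DecidableEq V] {D : LinkDiagram V}
  {G X : Finset V} {p q : V × ZMod 4}

variable (D) in
/-- The incident arcs of a nonempty segment `X` from the end `p`, other than the two at this end,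
given by their darts in `X`: the position to which the flype across `X` moves the group. -/
def farDarts (p : V × ZMod 4) (X : Finset V) : Finset (V × ZMod 4) :=
  (D.boundary X).filter fun d => D.opp d ∉ endDarts p

theorem mem_farDarts {d : V × ZMod 4} :
    d ∈ D.farDarts p X ↔ d ∈ D.boundary X ∧ D.opp d ∉ endDarts p := by
  rw [farDarts, Finset.mem_filter]

theorem IsEnd.isSegment_iff (hp : D.IsEnd G p) (hX : X.Nonempty) :
    D.IsSegment G p X ↔ Disjoint X G ∧ (D.boundary X).card = 4 ∧
      ∀ d ∈ endDarts p, (D.opp d).1 ∈ X := by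
  have hout : Disjoint X G → ∀ d ∈ endDarts p, d.1 ∉ X := fun hdisj d hd hdX =>
    Finset.disjoint_left.1 hdisj hdX (fst_eq_of_mem_endDarts hd ▸ hp.fst_mem)
  simp only [IsSegment, hX.ne_empty, false_or, mem_boundary, D.opp_opp]
  simp only [endDarts, Finset.mem_insert, Finset.mem_singleton, forall_eq_or_imp,
    forall_eq] at hout ⊢
  tauto

namespace IsSegment

theorem disjoint (h : D.IsSegment G p X) : Disjoint X G := by
  rcases h with rfl | h
  · exact Finset.disjoint_empty_left _
  · exact h.1

theorem opp_fst_mem (h : D.IsSegment G p X) (hp : D.IsEnd G p) (hX : X.Nonempty)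
    {d : V × ZMod 4} (hd : d ∈ endDarts p) : (D.opp d).1 ∈ X :=
  ((hp.isSegment_iff hX).1 h).2.2 d hd

theorem card_farDarts (h : D.IsSegment G p X) (hp : D.IsEnd G p) (hX : X.Nonempty) :
    (D.farDarts p X).card = 2 := by
  obtain ⟨hdisj, hcard, hmem⟩ := (hp.isSegment_iff hX).1 h
  have hnear : (D.boundary X).filter (fun d => D.opp d ∈ endDarts p) =
      (endDarts p).map D.opp.toEmbedding := by
    ext d
    rw [Finset.mem_filter, Finset.mem_map_equiv, ← D.opp.eq_symm_apply.2 (D.opp_opp d)]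
    refine ⟨And.right, fun hd => ⟨mem_boundary.2 ⟨?_, fun hdX => ?_⟩, hd⟩⟩
    · simpa only [D.opp_opp] using hmem _ hd
    · exact Finset.disjoint_left.1 hdisj hdX (fst_eq_of_mem_endDarts hd ▸ hp.fst_mem)
  have hsplit := Finset.card_filter_add_card_filter_not (s := D.boundary X)
    fun d => D.opp d ∈ endDarts p
  rw [hnear, Finset.card_map, card_endDarts, hcard] at hsplit
  exact Nat.add_left_cancel hsplit

theorem card_boundary_union_and_dartsBetween_subset (h : D.IsSegment G p X) (hG : D.IsAxis G p q)
    (hD : D.IsFourEdgeConnected) (hR : (X ∪ G)ᶜ.Nonempty) :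
    (D.boundary (X ∪ G)).card = 4 ∧ D.dartsBetween G X ⊆ endDarts p := by
  rcases X.eq_empty_or_nonempty with rfl | hX
  · rw [Finset.empty_union]
    exact ⟨hG.1, fun d hd => absurd (mem_dartsBetween.1 hd).2 (Finset.notMem_empty _)⟩
  have hend : endDarts p ⊆ D.dartsBetween G X := fun d hd =>
    mem_dartsBetween.2 ⟨fst_eq_of_mem_endDarts hd ▸ hG.isEnd.fst_mem,
      h.opp_fst_mem hG.isEnd hX hd⟩
  have hfour := hD _ (hX.mono Finset.subset_union_left) hR
  have hcount := D.card_boundary_union_add h.disjoint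
  have hcardX := ((hG.isEnd.isSegment_iff hX).1 h).2.1
  have hcardG := hG.1
  have htwo := Finset.card_le_card hend
  have hcomm := D.card_dartsBetween_comm G X
  rw [card_endDarts] at htwo
  refine ⟨by omega, (Finset.eq_of_subset_of_card_le hend ?_).ge⟩
  rw [card_endDarts]
  omega

theorem compl_union (h : D.IsSegment G p X) (hG : D.IsAxis G p q) (hD : D.IsFourEdgeConnected) :
    D.IsSegment G q (X ∪ G)ᶜ := by
  rcases (X ∪ G)ᶜ.eq_empty_or_nonempty with hR | hR
  · exact .inl hR
  obtain ⟨hcard, hGX⟩ := h.card_boundary_union_and_dartsBetween_subset hG hD hR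
  refine (hG.symm.isEnd.isSegment_iff hR).2 ⟨?_, ?_, fun d hd => ?_⟩
  · exact disjoint_compl_left.mono_right Finset.subset_union_right
  · rw [card_boundary_compl, hcard]
  · have hdG := mem_boundary.1 (isEnd_iff.1 hG.symm.isEnd hd)
    rw [Finset.mem_compl, Finset.mem_union, not_or]
    exact ⟨fun hdX => Finset.disjoint_left.1 hG.disjoint_endDarts
      (hGX (mem_dartsBetween.2 ⟨hdG.1, hdX⟩)) hd, hdG.2⟩

theorem compl_union_compl_union (h : D.IsSegment G p X) : ((X ∪ G)ᶜ ∪ G)ᶜ = X := by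
  rw [Finset.compl_union, compl_compl, ← Finset.sdiff_eq_inter_compl,
    Finset.union_sdiff_cancel_right h.disjoint]

theorem opp_mem_endDarts_or_of_mem_farDarts (h : D.IsSegment G p X) (hG : D.IsAxis G p q)
    {d : V × ZMod 4} (hd : d ∈ D.farDarts p X) :
    D.opp d ∈ endDarts q ∨ (D.opp d).1 ∈ (X ∪ G)ᶜ := by
  obtain ⟨hdX, hdp⟩ := mem_farDarts.1 hd
  rw [mem_boundary] at hdX
  by_cases hdG : (D.opp d).1 ∈ G
  · refine .inl (hG.mem_endDarts_of_notMem (mem_boundary.2 ⟨hdG, ?_⟩) hdp)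
    rw [D.opp_opp]
    exact Finset.disjoint_left.1 h.disjoint hdX.1
  · exact .inr (by simp [hdX.2, hdG])

theorem opp_fst_eq_of_mem_farDarts (h : D.IsSegment G p X) (hG : D.IsAxis G p q)
    (hR : (X ∪ G)ᶜ = ∅) {d : V × ZMod 4} (hd : d ∈ D.farDarts p X) : (D.opp d).1 = q.1 := by
  rcases h.opp_mem_endDarts_or_of_mem_farDarts hG hd with hdq | hdR
  · exact fst_eq_of_mem_endDarts hdq
  · exact absurd (hR ▸ hdR) (Finset.notMem_empty _)

theorem opp_fst_mem_of_mem_farDarts (h : D.IsSegment G p X) (hG : D.IsAxis G p q)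
    (hD : D.IsFourEdgeConnected) (hR : (X ∪ G)ᶜ.Nonempty) {d : V × ZMod 4}
    (hd : d ∈ D.farDarts p X) : (D.opp d).1 ∈ (X ∪ G)ᶜ := by
  refine (h.opp_mem_endDarts_or_of_mem_farDarts hG hd).resolve_left fun hdq => ?_
  have hdR := (h.compl_union hG hD).opp_fst_mem hG.symm.isEnd hR hdq
  rw [D.opp_opp] at hdR
  exact Finset.mem_compl.1 hdR
    (Finset.mem_union_left _ (mem_boundary.1 (mem_farDarts.1 hd).1).1)

/-- An arc from the end `p` that leads past `X` leaves `G` at the end `q`. -/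
theorem isLoner_and_isAdjacent (h : D.IsSegment G p X) (hG : D.IsAxis G p q) (hGrp : D.IsGroup G)
    (hX : X.Nonempty) {γ : V × ZMod 4} (hγ : γ.1 = p.1) (hγR : (D.opp γ).1 ∈ (X ∪ G)ᶜ) :
    D.IsLoner G ∧ D.IsAdjacent G X := by
  rw [Finset.mem_compl, Finset.mem_union, not_or] at hγR
  have hγq : γ ∈ endDarts q := by
    refine hG.mem_endDarts_of_notMem (mem_boundary.2 ⟨hγ ▸ hG.isEnd.fst_mem, hγR.2⟩) fun hγp => ?_
    exact hγR.1 (h.opp_fst_mem hG.isEnd hX hγp)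
  refine ⟨hG.isLoner hGrp (hγ.symm.trans (fst_eq_of_mem_endDarts hγq)), p, hG.isEnd, ?_, ?_⟩
  · exact h.opp_fst_mem hG.isEnd hX (Finset.mem_insert_self _ _)
  · exact h.opp_fst_mem hG.isEnd hX (Finset.mem_insert_of_mem (Finset.mem_singleton_self _))

theorem of_farDarts_subset_boundary (hG : D.IsAxis G p q) (hXG : Disjoint X G)
    (hX : (D.boundary X).card = 4) (hnear : D.farDarts q Gᶜ ⊆ D.boundary X) :
    D.IsSegment G p X := by
  have hmem : ∀ d ∈ endDarts p, D.opp d ∈ D.boundary X := fun d hd => by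
    have hdG := mem_boundary.1 (isEnd_iff.1 hG.isEnd hd)
    refine hnear (mem_farDarts.2 ⟨?_, ?_⟩)
    · simpa only [mem_boundary, Finset.mem_compl, D.opp_opp, not_not] using hdG.symm
    · rw [D.opp_opp]
      exact Finset.disjoint_left.1 hG.disjoint_endDarts hd
  exact .inr ⟨hXG, hX, hmem _ (Finset.mem_insert_self _ _),
    hmem _ (Finset.mem_insert_of_mem (Finset.mem_singleton_self _))⟩

theorem union (h : D.IsSegment G p X) (hG : D.IsAxis G p q) (hD : D.IsFourEdgeConnected)
    {S : Finset V} (hXS : Disjoint X S) (hXSG : Disjoint (X ∪ S) G)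
    (hS : (D.boundary S).card = 4) (hnear : D.farDarts q (X ∪ G)ᶜ ⊆ D.boundary S) :
    D.IsSegment G p (X ∪ S) := by
  rcases X.eq_empty_or_nonempty with rfl | hX
  · rw [Finset.empty_union] at hnear hXSG ⊢
    exact of_farDarts_subset_boundary hG hXSG hS hnear
  have hR := h.compl_union hG hD
  have hRne : (X ∪ G)ᶜ.Nonempty := by
    obtain ⟨d, hd⟩ := Finset.card_pos.1 (hS ▸ four_pos)
    have hdS := (mem_boundary.1 hd).1
    refine ⟨d.1, ?_⟩
    rw [Finset.mem_compl, Finset.mem_union, not_or]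
    exact ⟨Finset.disjoint_right.1 hXS hdS,
      Finset.disjoint_left.1 hXSG (Finset.mem_union_right X hdS)⟩
  have hlink : D.farDarts q (X ∪ G)ᶜ ⊆ D.dartsBetween S X := fun d hd => by
    refine mem_dartsBetween.2 ⟨(mem_boundary.1 (hnear hd)).1, ?_⟩
    have hdX := hR.opp_fst_mem_of_mem_farDarts hG.symm hD (h.compl_union_compl_union.symm ▸ hX) hd
    rwa [h.compl_union_compl_union] at hdX
  have htwo := Finset.card_le_card hlink
  rw [hR.card_farDarts hG.symm.isEnd hRne] at htwo
  have hfour := hD (X ∪ S) (hX.mono Finset.subset_union_left)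
    ⟨p.1, Finset.mem_compl.2 (Finset.disjoint_right.1 hXSG hG.isEnd.fst_mem)⟩
  have hcount := D.card_boundary_union_add hXS
  rw [card_dartsBetween_comm X S, hS, ((hG.isEnd.isSegment_iff hX).1 h).2.1] at hcount
  refine (hG.isEnd.isSegment_iff (hX.mono Finset.subset_union_left)).2 ⟨hXSG, by omega, ?_⟩
  exact fun d hd => Finset.mem_union_left S (h.opp_fst_mem hG.isEnd hX hd)

end IsSegment

end Segments

section FlypeSteps

variable {V : Type*} [Fintype V] [DecidableEq V] {D : LinkDiagram V}
  {G X Y : Finset V} {p q : V × ZMod 4}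

variable (D) in
/-- `X` and `Y` are consecutive among the segments from the end `p` of `G`, so that `Y \ X` is a
min-tangle in the orbit of `G`. The opposite end of `G` is `q`. -/
structure IsFlypeStep (G : Finset V) (p q : V × ZMod 4) (X Y : Finset V) : Prop where
  axis : D.IsAxis G p q
  left : D.IsSegment G p X
  right : D.IsSegment G p Y
  ssubset : X ⊂ Y
  consecutive : ∀ Z, D.IsSegment G p Z → X ⊆ Z → Z ⊆ Y → Z = X ∨ Z = Y

theorem isMinTangle_iff {H : Finset V} :
    D.IsMinTangle G H ↔ ∃ p q X Y, D.IsFlypeStep G p q X Y ∧ H = Y \ X := by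
  constructor
  · rintro ⟨p, q, hG, X, Y, hX, hY, hXY, hcons, hH⟩
    exact ⟨p, q, X, Y, ⟨hG, hX, hY, hXY, hcons⟩, hH⟩
  · rintro ⟨p, q, X, Y, ⟨hG, hX, hY, hXY, hcons⟩, hH⟩
    exact ⟨p, q, hG, X, Y, hX, hY, hXY, hcons, hH⟩

namespace IsFlypeStep

theorem right_nonempty (h : D.IsFlypeStep G p q X Y) : Y.Nonempty :=
  Finset.empty_ssubset.1 ((Finset.empty_subset X).trans_ssubset h.ssubset)

theorem reverse (h : D.IsFlypeStep G p q X Y) (hD : D.IsFourEdgeConnected) :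
    D.IsFlypeStep G q p (Y ∪ G)ᶜ (X ∪ G)ᶜ where
  axis := h.axis.symm
  left := h.right.compl_union h.axis hD
  right := h.left.compl_union h.axis hD
  ssubset := by
    obtain ⟨v, hvY, hvX⟩ := Finset.exists_of_ssubset h.ssubset
    have hvG := Finset.disjoint_left.1 h.right.disjoint hvY
    rw [Finset.compl_ssubset_compl, Finset.ssubset_iff_of_subset
      (Finset.union_subset_union_left h.ssubset.subset)]
    exact ⟨v, Finset.mem_union_left G hvY, fun hv => (Finset.mem_union.1 hv).elim hvX hvG⟩
  consecutive Z hZ hYZ hZX := by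
    have hcompl : ∀ {A B : Finset V}, A ⊆ B → (B ∪ G)ᶜ ⊆ (A ∪ G)ᶜ := fun hAB =>
      Finset.compl_subset_compl.2 (Finset.union_subset_union_left hAB)
    have hXZ := hcompl hZX
    have hZY := hcompl hYZ
    rw [h.left.compl_union_compl_union] at hXZ
    rw [h.right.compl_union_compl_union] at hZY
    rw [← hZ.compl_union_compl_union]
    exact (h.consecutive _ (hZ.compl_union h.axis.symm hD) hXZ hZY).symm.imp
      (fun hY => by rw [hY]) (fun hX => by rw [hX])

theorem compl_sdiff_compl (h : D.IsFlypeStep G p q X Y) : (X ∪ G)ᶜ \ (Y ∪ G)ᶜ = Y \ X := by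
  have hYG := Finset.disjoint_left.1 h.right.disjoint
  ext v
  simp only [Finset.mem_sdiff, Finset.mem_compl, Finset.mem_union]
  grind

theorem mem_farDarts_or_mem_farDarts (h : D.IsFlypeStep G p q X Y) {d : V × ZMod 4}
    (hd : d ∈ D.boundary (Y \ X)) : d ∈ D.farDarts q (X ∪ G)ᶜ ∨ d ∈ D.farDarts p Y := by
  obtain ⟨hdH, hdH'⟩ := mem_boundary.1 hd
  obtain ⟨hdY, hdX⟩ := Finset.mem_sdiff.1 hdH
  have hdG := Finset.disjoint_left.1 h.right.disjoint hdY
  simp only [mem_farDarts, mem_boundary, Finset.mem_compl, Finset.mem_union, not_or, not_and_or,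
    not_not]
  by_cases hdp : D.opp d ∈ endDarts p
  · refine .inl ⟨⟨⟨hdX, hdG⟩, ?_⟩, Finset.disjoint_left.1 h.axis.disjoint_endDarts hdp⟩
    exact .inr (fst_eq_of_mem_endDarts hdp ▸ h.axis.isEnd.fst_mem)
  by_cases hdY' : (D.opp d).1 ∈ Y
  · have hoppX : (D.opp d).1 ∈ X := by
      by_contra hX
      exact hdH' (Finset.mem_sdiff.2 ⟨hdY', hX⟩)
    refine .inl ⟨⟨⟨hdX, hdG⟩, .inl hoppX⟩, fun hdq => ?_⟩
    exact Finset.disjoint_left.1 h.left.disjoint hoppX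
      (fst_eq_of_mem_endDarts hdq ▸ h.axis.symm.isEnd.fst_mem)
  · exact .inr ⟨⟨hdY, hdY'⟩, hdp⟩

theorem eq_sdiff_of_farDarts_subset (h : D.IsFlypeStep G p q X Y) (hD : D.IsFourEdgeConnected)
    {S : Finset V} (hSH : S ⊆ Y \ X) (hS : (D.boundary S).card = 4)
    (hnear : D.farDarts q (X ∪ G)ᶜ ⊆ D.boundary S) : S = Y \ X := by
  obtain ⟨hSY, hSX⟩ := Finset.subset_sdiff.1 hSH
  have hXSY := Finset.union_subset h.ssubset.subset hSY
  have hseg := h.left.union h.axis hD hSX.symm (h.right.disjoint.mono_left hXSY) hS hnear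
  rcases h.consecutive _ hseg Finset.subset_union_left hXSY with hX | hY
  · have hempty := hSX.eq_bot_of_le (Finset.union_eq_left.1 hX)
    simp [hempty, boundary] at hS
  · rw [← hY, Finset.union_sdiff_cancel_left hSX.symm]

theorem eq_of_mem_farDarts_left (h : D.IsFlypeStep G p q X Y) (hD : D.IsFourEdgeConnected)
    {S : Finset V} (hSH : S ⊂ Y \ X) (hS : (D.boundary S).card = 4) {c d : V × ZMod 4}
    (hcS : c ∈ D.boundary S) (hdS : d ∈ D.boundary S) (hc : c ∈ D.farDarts q (X ∪ G)ᶜ)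
    (hd : d ∈ D.farDarts q (X ∪ G)ᶜ) : c = d := by
  by_contra hcd
  have hnear : {c, d} = D.farDarts q (X ∪ G)ᶜ := by
    apply Finset.eq_of_subset_of_card_le
    · exact Finset.insert_subset hc (Finset.singleton_subset_iff.2 hd)
    · rw [Finset.card_pair hcd, (h.left.compl_union h.axis hD).card_farDarts h.axis.symm.isEnd
        (h.reverse hD).right_nonempty]
  refine hSH.ne (h.eq_sdiff_of_farDarts_subset hD hSH.subset hS ?_)
  rw [← hnear]
  exact Finset.insert_subset hcS (Finset.singleton_subset_iff.2 hdS)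

theorem eq_of_mem_farDarts_right (h : D.IsFlypeStep G p q X Y) (hD : D.IsFourEdgeConnected)
    {S : Finset V} (hSH : S ⊂ Y \ X) (hS : (D.boundary S).card = 4) {c d : V × ZMod 4}
    (hcS : c ∈ D.boundary S) (hdS : d ∈ D.boundary S) (hc : c ∈ D.farDarts p Y)
    (hd : d ∈ D.farDarts p Y) : c = d := by
  rw [← h.right.compl_union_compl_union] at hc hd
  exact (h.reverse hD).eq_of_mem_farDarts_left hD (h.compl_sdiff_compl.symm ▸ hSH) hS hcS hdS hc hd

theorem mem_farDarts_and_mem_farDarts_of_isEnd (h : D.IsFlypeStep G p q X Y)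
    (hD : D.IsFourEdgeConnected) {S : Finset V} (hSH : S ⊂ Y \ X)
    (hS : (D.boundary S).card = 4) {c : V × ZMod 4} (hcS : D.IsEnd S c)
    (hcH : D.IsEnd (Y \ X) c) :
    (c ∈ D.farDarts q (X ∪ G)ᶜ ∧ turn 1 c ∈ D.farDarts p Y) ∨
      (turn 1 c ∈ D.farDarts q (X ∪ G)ᶜ ∧ c ∈ D.farDarts p Y) := by
  rcases h.mem_farDarts_or_mem_farDarts hcH.1 with hc | hc <;>
    rcases h.mem_farDarts_or_mem_farDarts hcH.2 with hc' | hc'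
  · exact absurd (h.eq_of_mem_farDarts_left hD hSH hS hcS.2 hcS.1 hc' hc) (turn_one_ne c)
  · exact .inl ⟨hc, hc'⟩
  · exact .inr ⟨hc', hc⟩
  · exact absurd (h.eq_of_mem_farDarts_right hD hSH hS hcS.2 hcS.1 hc' hc) (turn_one_ne c)

theorem opp_fst_notMem_compl_of_mem_left (h : D.IsFlypeStep G p q X Y)
    (hD : D.IsFourEdgeConnected) {γ : V × ZMod 4} (hγ : γ.1 ∈ X) :
    (D.opp γ).1 ∉ (Y ∪ G)ᶜ := fun hγR => by
  rw [Finset.mem_compl, Finset.mem_union, not_or] at hγR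
  have hX : X.Nonempty := ⟨γ.1, hγ⟩
  have hG := h.axis.isEnd
  have hlink : D.dartsBetween X (Y \ X) ⊆ D.farDarts p X := fun d hd => by
    obtain ⟨hdX, hdH⟩ := mem_dartsBetween.1 hd
    obtain ⟨hdY, hdX'⟩ := Finset.mem_sdiff.1 hdH
    refine mem_farDarts.2 ⟨mem_boundary.2 ⟨hdX, hdX'⟩, fun hdp => ?_⟩
    exact Finset.disjoint_left.1 h.right.disjoint hdY (fst_eq_of_mem_endDarts hdp ▸ hG.fst_mem)
  have hcount := D.card_boundary_union_add (Finset.disjoint_sdiff (s := X) (t := Y))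
  have hH : 4 ≤ (D.boundary (Y \ X)).card :=
    hD _ (Finset.sdiff_nonempty.2 h.ssubset.not_subset) ⟨γ.1, by simp [hγ]⟩
  rw [Finset.union_sdiff_of_subset h.ssubset.subset, ((hG.isSegment_iff hX).1 h.left).2.1,
    ((hG.isSegment_iff h.right_nonempty).1 h.right).2.1] at hcount
  have hfar : γ ∈ D.farDarts p X := by
    refine mem_farDarts.2 ⟨mem_boundary.2 ⟨hγ, fun hγX => ?_⟩, fun hγp => ?_⟩
    · exact hγR.1 (h.ssubset.subset hγX)
    · exact hγR.2 (fst_eq_of_mem_endDarts hγp ▸ hG.fst_mem)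
  rw [← Finset.eq_of_subset_of_card_le hlink
    (by rw [h.left.card_farDarts hG hX]; omega), mem_dartsBetween] at hfar
  exact hγR.1 (Finset.mem_sdiff.1 hfar.2).1

theorem isLoner_and_isAdjacent (h : D.IsFlypeStep G p q X Y) (hD : D.IsFourEdgeConnected)
    (hGrp : D.IsGroup G) {l r γ : V × ZMod 4} (hl : l ∈ D.farDarts q (X ∪ G)ᶜ)
    (hr : r ∈ D.farDarts p Y) (hγl : γ.1 = (D.opp l).1) (hγr : (D.opp γ).1 = (D.opp r).1)
    (hne : γ.1 ≠ (D.opp γ).1) (hbigon : ¬ D.Bigon γ.1 (D.opp γ).1) :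
    D.IsLoner G ∧ D.IsAdjacent G (Y \ X) := by
  have hXc := h.left.compl_union h.axis hD
  have hXcc := h.left.compl_union_compl_union
  have hright : (Y ∪ G)ᶜ = ∅ → (D.opp γ).1 = q.1 := fun hR =>
    hγr.trans (h.right.opp_fst_eq_of_mem_farDarts h.axis hR hr)
  have hright' : (Y ∪ G)ᶜ.Nonempty → (D.opp γ).1 ∈ (Y ∪ G)ᶜ := fun hR =>
    hγr ▸ h.right.opp_fst_mem_of_mem_farDarts h.axis hD hR hr
  rcases X.eq_empty_or_nonempty with hX | hX
  · have hleft : γ.1 = p.1 :=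
      hγl.trans (hXc.opp_fst_eq_of_mem_farDarts h.axis.symm (hXcc.trans hX) hl)
    rcases (Y ∪ G)ᶜ.eq_empty_or_nonempty with hR | hR
    · refine absurd ?_ hbigon
      rw [hleft] at hne ⊢
      exact h.axis.isEnd.bigon hGrp hleft (hright hR ▸ h.axis.symm.isEnd.fst_mem) hne
    · rw [hX, Finset.sdiff_empty]
      exact h.right.isLoner_and_isAdjacent h.axis hGrp h.right_nonempty hleft (hright' hR)
  · have hleft : γ.1 ∈ X := by
      have hlX := hXc.opp_fst_mem_of_mem_farDarts h.axis.symm hD (hXcc.symm ▸ hX) hl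
      rwa [hXcc, ← hγl] at hlX
    rcases (Y ∪ G)ᶜ.eq_empty_or_nonempty with hR | hR
    · rw [← h.compl_sdiff_compl, hR, Finset.sdiff_empty]
      refine hXc.isLoner_and_isAdjacent h.axis.symm hGrp (h.reverse hD).right_nonempty
        (hright hR) ?_
      rwa [D.opp_opp, hXcc]
    · exact absurd (hright' hR) (h.opp_fst_notMem_compl_of_mem_left hD hleft)

end IsFlypeStep

end FlypeSteps

end LinkDiagram

theorem mainTheorem2_general {V : Type*} [Fintype V] [DecidableEq V] {D : LinkDiagram V}
    (hD : D.IsFourEdgeConnected) {G H T : Finset V} (hG : D.IsOrbiter G H) (hH : H.Nontrivial)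
    (hT : D.IsOTSTangle T) {a : V} (hHT : H ∩ T = {a}) : D.IsLoner G ∧ D.IsAdjacent G H := by
  obtain ⟨p, q, X, Y, h, rfl⟩ := LinkDiagram.isMinTangle_iff.1 hG.2
  have haH : a ∈ Y \ X := Finset.inter_subset_left (hHT.symm ▸ Finset.mem_singleton_self a)
  obtain ⟨c, hca, hcH, hcT, hcT', hne⟩ := hT.exists_isEnd_of_inter_eq_singleton hHT
  obtain ⟨b, -, hba⟩ := hH.exists_ne a
  have hthird : ∀ {l r : V × ZMod 4}, l ∈ D.farDarts q (X ∪ G)ᶜ → r ∈ D.farDarts p Y →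
      (D.opp l).1 ∈ T → (D.opp r).1 ∈ T → (D.opp l).1 ≠ (D.opp r).1 →
      D.IsLoner G ∧ D.IsAdjacent G (Y \ X) := fun hl hr hlT hrT hlr => by
    obtain ⟨γ, hγl, hγr⟩ := hT.exists_dart hlT hrT hlr
    rw [← hγl, ← hγr] at hlr
    exact h.isLoner_and_isAdjacent hD hG.1 hl hr hγl hγr hlr
      (hT.not_bigon (hγl ▸ hlT) (hγr ▸ hrT))
  rcases h.mem_farDarts_and_mem_farDarts_of_isEnd hD
    (Finset.ssubset_iff_subset_ne.2 ⟨Finset.singleton_subset_iff.2 haH, hH.ne_singleton.symm⟩)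
    (hD.card_boundary_singleton hba.symm) hca hcH with ⟨hl, hr⟩ | ⟨hl, hr⟩
  · exact hthird hl hr hcT hcT' hne
  · exact hthird hl hr hcT' hcT hne.symm

theorem mainTheorem2 {V : Type*} [Fintype V] [DecidableEq V] (D : LinkDiagram V)
    (hK : D.IsPrimeAlternatingKnot) (hfull : D.IsFullGroupConfiguration)
    (GD : Finset V) (hGD : D.IsDrotsTwoGroup GD)
    (hOTS : ∃ T, D.IsOTSTangle T ∧ ∃ c ∈ GD, c ∈ T) :
    ∀ G, D.IsOrbiter G GD → D.IsLoner G ∧ D.IsAdjacent G GD := by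
  intro G hG
  obtain ⟨T, hT, c, hc, hcT⟩ := hOTS
  have hGDT := hT.inter_eq_singleton hGD.1 hGD.2.1 hc hcT
  have hGD' := Finset.one_lt_card_iff_nontrivial.1 (hGD.2.1 ▸ one_lt_two)
  exact mainTheorem2_general (hK.knot.isFourEdgeConnected hK.prime) hG hGD' hT hGDT
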